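/- Let $(\mathbb{F},\mathbb{A})$ be $(\mathbb{R},\mathbb{H})$ or $(\mathbb{C},\mathbb{O})$, where $\mathbb{H}\subset\mathbb{O}$ are the real quaternions and the real octonions $u+\mathbf{k}v$ ($u,v\in\mathbb{H}$), with $(\mathbf{k}u)v=\mathbf{k}(vu)=\bar v(\mathbf{k}u)$, $(\mathbf{k}u)(\mathbf{k}v)=-v\bar u$, conjugation $\overline{u+\mathbf{k}v}=\bar u-\mathbf{k}v$ and $|u+\mathbf{k}v|^2=|u|^2+|v|^2$. View $\mathbb{A}$ and $\mathbb{O}$ as $\mathbb{F}$-vector spaces by right multiplication, let $(x|y)$ be the $\mathbb{F}$-part (the real, respectively complex, part) of $\bar x y$, let $\perp$ be the corresponding orthogonality relation, and let $\mathrm{Pu}_\mathbb{F}$ be the subspace of the elements whose $\mathbb{F}$-part is $0$. The geometry $\Gamma=\Gamma_\mathbb{F}(\mathbb{A})$ has the following elements. The points are the one-dimensional subspaces $[y]$ of $\mathrm{Pu}_\mathbb{F}(\mathbb{A})$. The lines are the sets $[x,u]=\{(xt,ut)\mid t\in\mathbb{F}\setminus\{0\}\}$ with $x\in\mathrm{Pu}_\mathbb{F}(\mathbb{A})$,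 $u\in\mathrm{Pu}_\mathbb{F}(\mathbb{O})$ and $|x|=|u|\neq 0$. The planes are the $\mathbb{F}$-linear multiplicative maps $\phi:\mathbb{A}\to\mathbb{O}$ that preserve $(\cdot|\cdot)$. Every point is incident with every plane; $[y]$ is incident with $[x,u]$ when $x\perp y$; $[x,u]$ is incident with $\phi$ when $\phi(x)=u$. Two lines are coplanar when some plane is incident with both. A primitive path is a closed path $\alpha=(p,L,q,M,p)$ with $p,q$ points and $L,M$ lines, each incident with both points. It is degenerate if $p=q$ or $L=M$, and orthogonal if $p\perp q$. If $p\neq q$, one can write $L=[a,u]$ and $M=[a,v]$ with the same $a$, and the line-invariant of $\alpha$ is $\ell(\alpha)=(u|v)/(|u||v|)$, which does not depend on the choice of $a$. Let $\alpha$ be non-degenerate. A line $N$ is admissible for $\alpha$ if $q$ is on $N$ and $N$ is coplanar with $L$ and coplanar with $M$. For such an $N$ and a point $r$ of $N$, a shift of $\alpha$ from $q$ to $r$ along $N$ is a primitive path $(p,L',r,M',p)$ such that $L'$ is a line of a plane on $N$ and $L$, and $M'$ is a line of a plane on $N$ and $M$. It is an orthogonal shift along $N$ if $p\perp r$; when there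 is exactly one orthogonal shift of $\alpha$ along $N$, it is denoted by $\sigma^N_\perp(\alpha)$. **Lemma.** Let $\alpha$ be a non-orthogonal, non-degenerate primitive path of $\Gamma_\mathbb{F}(\mathbb{A})$. Then there is a line $N$ admissible for $\alpha$ such that $\alpha$ has exactly one orthogonal shift $\sigma^N_\perp(\alpha)$ along $N$, and its line-invariant satisfies $\ell(\sigma^N_\perp(\alpha))\neq -1$. -/

import Mathlib

open scoped Quaternion

namespace OP2

/-! ### The real octonions -/

/-- The real octonions `u + 𝐤 v` with `u v : ℍ`; `fst` is `u` and `snd` is `v`. -/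
@[ext]
structure Octonion where
  fst : ℍ[ℝ]
  snd : ℍ[ℝ]

namespace Octonion

noncomputable instance : Zero Octonion := ⟨⟨0, 0⟩⟩
noncomputable instance : One Octonion := ⟨⟨1, 0⟩⟩
noncomputable instance : Add Octonion := ⟨fun x y => ⟨x.fst + y.fst, x.snd + y.snd⟩⟩
noncomputable instance : Neg Octonion := ⟨fun x => ⟨-x.fst, -x.snd⟩⟩

/-- The product determined by `(𝐤u)v = 𝐤(vu) = v̄(𝐤u)` and `(𝐤u)(𝐤v) = -vū`. -/
noncomputable instance : Mul Octonion :=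
  ⟨fun x y => ⟨x.fst * y.fst - y.snd * star x.snd, star x.fst * y.snd + y.fst * x.snd⟩⟩

/-- The conjugation `u + 𝐤v ↦ ū - 𝐤v`. -/
noncomputable instance : Star Octonion := ⟨fun x => ⟨star x.fst, -x.snd⟩⟩

/-- The norm `|u + 𝐤v| = √(|u|² + |v|²)`. -/
noncomputable instance : Norm Octonion := ⟨fun x => Real.sqrt (‖x.fst‖ ^ 2 + ‖x.snd‖ ^ 2)⟩

@[simp] theorem zero_fst : (0 : Octonion).fst = 0 := rfl
@[simp] theorem zero_snd : (0 : Octonion).snd = 0 := rfl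
@[simp] theorem one_fst : (1 : Octonion).fst = 1 := rfl
@[simp] theorem one_snd : (1 : Octonion).snd = 0 := rfl
@[simp] theorem add_fst (x y : Octonion) : (x + y).fst = x.fst + y.fst := rfl
@[simp] theorem add_snd (x y : Octonion) : (x + y).snd = x.snd + y.snd := rfl
@[simp] theorem neg_fst (x : Octonion) : (-x).fst = -x.fst := rfl
@[simp] theorem neg_snd (x : Octonion) : (-x).snd = -x.snd := rfl
@[simp] theorem mul_fst (x y : Octonion) :
    (x * y).fst = x.fst * y.fst - y.snd * star x.snd := rfl
@[simp] theorem mul_snd (x y : Octonion) :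
    (x * y).snd = star x.fst * y.snd + y.fst * x.snd := rfl
@[simp] theorem star_fst (x : Octonion) : (star x).fst = star x.fst := rfl
@[simp] theorem star_snd (x : Octonion) : (star x).snd = -x.snd := rfl
theorem norm_def (x : Octonion) : ‖x‖ = Real.sqrt (‖x.fst‖ ^ 2 + ‖x.snd‖ ^ 2) := rfl

noncomputable instance : AddCommGroup Octonion where
  add_assoc x y z := by ext1 <;> simp only [add_fst, add_snd, add_assoc]
  zero_add x := by ext1 <;> simp only [add_fst, add_snd, zero_fst, zero_snd, zero_add]
  add_zero x := by ext1 <;> simp only [add_fst, add_snd, zero_fst, zero_snd, add_zero]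
  neg_add_cancel x := by
    ext1 <;> simp only [add_fst, add_snd, neg_fst, neg_snd, zero_fst, zero_snd, neg_add_cancel]
  add_comm x y := by
    ext1
    · exact add_comm x.fst y.fst
    · exact add_comm x.snd y.snd
  nsmul := nsmulRec
  zsmul := zsmulRec

noncomputable instance : NonAssocRing Octonion where
  left_distrib x y z := by ext1 <;> simp [mul_add, add_mul] <;> abel
  right_distrib x y z := by ext1 <;> simp [mul_add, add_mul] <;> abel
  zero_mul x := by ext1 <;> simp
  mul_zero x := by ext1 <;> simp
  one_mul x := by ext1 <;> simp
  mul_one x := by ext1 <;> simp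

/-- The inclusion `ℂ ⊆ ℍ ⊆ 𝕆`. -/
noncomputable def ofComplex (c : ℂ) : Octonion := ⟨(c : ℍ[ℝ]), 0⟩

/-- The complex scalar multiplication on the octonions is the product of octonions with the
complex scalar on the right. -/
noncomputable instance : SMul ℂ Octonion := ⟨fun c x => x * ofComplex c⟩

theorem complex_smul_def (c : ℂ) (x : Octonion) : c • x = x * ofComplex c := rfl

@[simp] theorem complex_smul_fst (c : ℂ) (x : Octonion) :
    (c • x).fst = x.fst * (c : ℍ[ℝ]) := by
  simp [complex_smul_def, ofComplex]

@[simp] theorem complex_smul_snd (c : ℂ) (x : Octonion) :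
    (c • x).snd = (c : ℍ[ℝ]) * x.snd := by
  simp [complex_smul_def, ofComplex]

/-- The octonions as a (right) vector space over `ℂ`. The real vector space structure is the one
obtained by restricting scalars. -/
noncomputable instance : Module ℂ Octonion where
  one_smul x := by ext1 <;> simp
  mul_smul a b x := by
    ext1
    · rw [mul_comm a b]; simp [mul_assoc]
    · simp [mul_assoc]
  smul_zero a := by ext1 <;> simp
  smul_add a x y := by ext1 <;> simp [mul_add, add_mul]
  add_smul a b x := by ext1 <;> simp [mul_add, add_mul]
  zero_smul x := by ext1 <;> simp

@[simp] theorem real_smul_fst (r : ℝ) (x : Octonion) : (r • x).fst = r • x.fst := by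
  have h : r • x = (r : ℂ) • x := rfl
  rw [h, complex_smul_fst]
  ext <;> simp [mul_comm]

@[simp] theorem real_smul_snd (r : ℝ) (x : Octonion) : (r • x).snd = r • x.snd := by
  have h : r • x = (r : ℂ) • x := rfl
  rw [h, complex_smul_snd]
  ext <;> simp

theorem norm_sq (x : Octonion) : ‖x‖ ^ 2 = ‖x.fst‖ ^ 2 + ‖x.snd‖ ^ 2 := by
  rw [norm_def, Real.sq_sqrt (by positivity)]

end Octonion

/-! ### `𝔽`-parts, the form `(·|·)_𝔽` and `𝔽`-pure elements -/

/-- The `𝔽`-part of the elements of `𝔸`, where `𝔽` is `ℝ` or `ℂ`. This is only used through the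
three instances below; the two laws, proved there, give that `(L|M)` is well defined. -/
class HasFPart (F A : Type) [RCLike F] [NonAssocRing A] [Star A] [Norm A] [Module F A] where
  fPart : A →ₗ[F] F
  fPart_star_smul : ∀ (t : F) (x y : A),
    fPart (star (t • x) * (t • y)) = ((‖t‖ ^ 2 : ℝ) : F) * fPart (star x * y)
  norm_smul' : ∀ (t : F) (x : A), ‖t • x‖ = ‖t‖ * ‖x‖

/-- The real part of a quaternion. -/
noncomputable instance : HasFPart ℝ ℍ[ℝ] where
  fPart := { toFun := fun x => x.re, map_add' := by simp, map_smul' := by simp }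
  fPart_star_smul t x y := by simp; ring
  norm_smul' t x := norm_smul t x

/-- The real part of an octonion. -/
noncomputable instance : HasFPart ℝ Octonion where
  fPart := { toFun := fun x => x.fst.re, map_add' := by simp, map_smul' := by simp }
  fPart_star_smul t x y := by
    change (star (t • x) * t • y).fst.re = ‖t‖ ^ 2 * (star x * y).fst.re
    simp; ring
  norm_smul' t x := by
    refine (sq_eq_sq₀ (Real.sqrt_nonneg _)
      (mul_nonneg (norm_nonneg t) (Real.sqrt_nonneg _))).1 ?_
    change ‖t • x‖ ^ 2 = (‖t‖ * ‖x‖) ^ 2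
    rw [mul_pow, Octonion.norm_sq, Octonion.norm_sq]
    simp only [Octonion.real_smul_fst, Octonion.real_smul_snd, norm_smul]
    ring

/-- The complex part of an octonion. -/
noncomputable instance : HasFPart ℂ Octonion where
  fPart :=
    { toFun := fun x => ⟨x.fst.re, x.fst.imI⟩
      map_add' := fun x y => by apply Complex.ext <;> simp
      map_smul' := fun c x => by apply Complex.ext <;> simp <;> ring }
  fPart_star_smul t x y := by
    have h : ‖t‖ ^ 2 = t.re ^ 2 + t.im ^ 2 := by
      rw [Complex.sq_norm, Complex.normSq_apply]; ring
    rw [h]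
    apply Complex.ext <;> simp [pow_two] <;> ring
  norm_smul' t x := by
    refine (sq_eq_sq₀ (Real.sqrt_nonneg _)
      (mul_nonneg (norm_nonneg t) (Real.sqrt_nonneg _))).1 ?_
    change ‖t • x‖ ^ 2 = (‖t‖ * ‖x‖) ^ 2
    rw [mul_pow, Octonion.norm_sq, Octonion.norm_sq]
    simp only [Octonion.complex_smul_fst, Octonion.complex_smul_snd, norm_mul]
    have h : ‖(t : ℍ[ℝ])‖ ^ 2 = ‖t‖ ^ 2 := by
      rw [pow_two, ← Quaternion.normSq_eq_norm_mul_self, Quaternion.normSq_def',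
        Complex.sq_norm, Complex.normSq_apply]
      simp; ring
    rw [mul_pow, mul_pow, h]
    ring

section Generic

variable (F A : Type) [RCLike F] [NonAssocRing A] [Star A] [Norm A] [Module F A] [HasFPart F A]

/-- The inner product `(x|y)_𝔽`, the `𝔽`-part of `x̄y`. -/
noncomputable def form (x y : A) : F := HasFPart.fPart (F := F) (star x * y)

/-- The space `Pu_𝔽(𝔸)` of `𝔽`-pure elements, those whose `𝔽`-part vanishes
(equivalently, those orthogonal to `𝔽` for the form `Re(x̄y)`). -/
noncomputable def Pu : Submodule F A := LinearMap.ker (HasFPart.fPart (F := F) (A := A))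

end Generic

theorem form_real_quaternion (x y : ℍ[ℝ]) : form ℝ ℍ[ℝ] x y = (star x * y).re := rfl

theorem form_real_octonion (x y : Octonion) : form ℝ Octonion x y = (star x * y).fst.re := rfl

theorem form_complex_octonion (x y : Octonion) :
    form ℂ Octonion x y = ⟨(star x * y).fst.re, (star x * y).fst.imI⟩ := rfl

theorem mem_Pu_real_quaternion (x : ℍ[ℝ]) : x ∈ Pu ℝ ℍ[ℝ] ↔ x.re = 0 := Iff.rfl

theorem mem_Pu_real_octonion (x : Octonion) : x ∈ Pu ℝ Octonion ↔ x.fst.re = 0 := Iff.rfl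

theorem mem_Pu_complex_octonion (x : Octonion) :
    x ∈ Pu ℂ Octonion ↔ x.fst.re = 0 ∧ x.fst.imI = 0 := Complex.ext_iff

/-! ### The geometry `Γ_𝔽(𝔸)` -/

section Geometry

variable (F A : Type) [RCLike F] [NonAssocRing A] [Star A] [Norm A] [Module F A] [HasFPart F A]
variable [Module F Octonion] [HasFPart F Octonion]

/-- Points: the one-dimensional subspaces of `Pu_𝔽(𝔸)`. -/
abbrev Point : Type := Projectivization F (Pu F A)

/-- The set of pairs `[x,u] = {(xt,ut) | t ∈ 𝔽*}`. -/
def pairClass {F A : Type} [RCLike F] [NonAssocRing A] [Module F A] [Module F Octonion]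
    (x : A) (u : Octonion) : Set (A × Octonion) :=
  {w | ∃ t : F, t ≠ 0 ∧ w = (t • x, t • u)}

/-- Lines: the sets `[x,u]` with `x ∈ Pu_𝔽(𝔸)`, `u ∈ Pu_𝔽(𝕆)` and `|x| = |u| ≠ 0`. -/
@[ext]
structure Line where
  carrier : Set (A × Octonion)
  exists_rep : ∃ x ∈ Pu F A, ∃ u ∈ Pu F Octonion,
    ‖x‖ = ‖u‖ ∧ ‖u‖ ≠ 0 ∧ carrier = pairClass (F := F) x u

/-- Planes: the sharp `𝔽`-morphisms `𝔸 → 𝕆`, that is the `𝔽`-linear maps that preserve the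
product and `(·|·)_𝔽`. -/
structure Plane extends A →ₗ[F] Octonion where
  map_mul' : ∀ x y : A, toFun (x * y) = toFun x * toFun y
  map_form' : ∀ x y : A, form F Octonion (toFun x) (toFun y) = form F A x y

variable {F A}

/-- Orthogonality of points with respect to `(·|·)_𝔽`. -/
def Point.Perp (p q : Point F A) : Prop :=
  ∀ x ∈ p.submodule, ∀ y ∈ q.submodule, form F A x y = 0

/-- The point `[y]` and the line `[x,u]` are incident when `y ∈ x^⊥`. -/
def Point.On (p : Point F A) (L : Line F A) : Prop :=
  ∀ w ∈ L.carrier, ∀ y ∈ p.submodule, form F A w.1 y = 0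

/-- The line `[x,u]` and the plane `φ` are incident when `φ(x) = u`. -/
def Line.On (L : Line F A) (φ : Plane F A) : Prop :=
  ∀ w ∈ L.carrier, φ.toLinearMap w.1 = w.2

/-- Two lines are coplanar when some plane is incident with both. -/
def Line.Coplanar (L M : Line F A) : Prop := ∃ φ : Plane F A, L.On φ ∧ M.On φ

open Classical in
/-- The scalar `(L|M) = (u|v)/(|u||v|)`, where `L = [a,u]` and `M = [a,v]` are represented with
the same first component `a`. Such representations exist when `L` and `M` have the same shadow;
the value `0` is used otherwise. -/
noncomputable def Line.inner (L M : Line F A) : F :=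
  if h : ∃ w : A × Octonion × Octonion, (w.1, w.2.1) ∈ L.carrier ∧ (w.1, w.2.2) ∈ M.carrier then
    form F Octonion h.choose.2.1 h.choose.2.2 /
      ((‖h.choose.2.1‖ * ‖h.choose.2.2‖ : ℝ) : F)
  else 0

/-- `(L|M)` does not depend on the choice of the common first component. -/
theorem Line.inner_eq (L M : Line F A) {a : A} {u v : Octonion}
    (hu : (a, u) ∈ L.carrier) (hv : (a, v) ∈ M.carrier) :
    L.inner M = form F Octonion u v / ((‖u‖ * ‖v‖ : ℝ) : F) := by
  have h : ∃ w : A × Octonion × Octonion,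
      (w.1, w.2.1) ∈ L.carrier ∧ (w.1, w.2.2) ∈ M.carrier := ⟨(a, u, v), hu, hv⟩
  rw [Line.inner, dif_pos h]
  obtain ⟨h1, h2⟩ := h.choose_spec
  generalize h.choose = w at h1 h2 ⊢
  obtain ⟨b, u', v'⟩ := w
  dsimp only at h1 h2 ⊢
  -- all members of a line are proportional by a nonzero scalar
  have key : ∀ (K : Line F A) {y z : A} {s r : Octonion}, (y, s) ∈ K.carrier →
      (z, r) ∈ K.carrier → ‖y‖ ≠ 0 ∧ ∃ t : F, t ≠ 0 ∧ z = t • y ∧ r = t • s := by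
    intro K y z s r hy hz
    obtain ⟨x, -, c, -, hn, hc, hK⟩ := K.exists_rep
    rw [hK] at hy hz
    obtain ⟨t1, ht1, e1⟩ := hy
    obtain ⟨t2, ht2, e2⟩ := hz
    obtain ⟨rfl, rfl⟩ := Prod.mk.inj e1
    obtain ⟨rfl, rfl⟩ := Prod.mk.inj e2
    refine ⟨?_, t2 * t1⁻¹, by positivity, ?_, ?_⟩
    · rw [HasFPart.norm_smul', hn]
      exact mul_ne_zero (norm_ne_zero_iff.2 ht1) hc
    · rw [smul_smul, inv_mul_cancel_right₀ ht1]
    · rw [smul_smul, inv_mul_cancel_right₀ ht1]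
  obtain ⟨ha, t, ht, e1, rfl⟩ := key L hu h1
  obtain ⟨-, t', ht', e2, rfl⟩ := key M hv h2
  have htt : t' = t := by
    by_contra hne
    have h0 : (t' - t) • a = 0 := by rw [sub_smul, ← e1, ← e2, sub_self]
    have ha0 : a = 0 := (smul_eq_zero.1 h0).resolve_left (sub_ne_zero.2 hne)
    apply ha
    have := HasFPart.norm_smul' (0 : F) a
    rwa [zero_smul, norm_zero, zero_mul, ← ha0] at this
  subst htt
  have hn : ((‖t'‖ ^ 2 : ℝ) : F) ≠ 0 := by
    have := norm_ne_zero_iff.2 ht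
    exact_mod_cast pow_ne_zero 2 this
  rw [form, HasFPart.fPart_star_smul, HasFPart.norm_smul', HasFPart.norm_smul', form,
    show ‖t'‖ * ‖u‖ * (‖t'‖ * ‖v‖) = ‖t'‖ ^ 2 * (‖u‖ * ‖v‖) by ring, RCLike.ofReal_mul,
    mul_div_mul_left _ _ hn]

/-! ### Primitive paths and shifts -/

variable (F A)

/-- A primitive path: a closed path `(p, L, q, M, p)` with `p`, `q` points and `L`, `M` lines. -/
@[ext]
structure PrimitivePath where
  p : Point F A
  L : Line F A
  q : Point F A
  M : Line F A
  p_on_L : p.On L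
  q_on_L : q.On L
  q_on_M : q.On M
  p_on_M : p.On M

variable {F A}

namespace PrimitivePath

/-- `α` is degenerate when `p = q` or `L = M`. -/
def Degenerate (α : PrimitivePath F A) : Prop := α.p = α.q ∨ α.L = α.M

/-- `α` is orthogonal when `p ⊥ q`. -/
def Orthogonal (α : PrimitivePath F A) : Prop := α.p.Perp α.q

/-- The line-invariant `ℓ(α) = (L|M)`. -/
noncomputable def lineInvariant (α : PrimitivePath F A) : F := α.L.inner α.M

/-- `N` is admissible for `α = (p,L,q,M,p)` when it is a line on `q` coplanar with each of `L`
and `M`. (Used for non-degenerate `α`.) -/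
def Admissible (α : PrimitivePath F A) (N : Line F A) : Prop :=
  α.q.On N ∧ N.Coplanar α.L ∧ N.Coplanar α.M

/-- `β = (p,L',r,M',p)` is the shift of `α = (p,L,q,M,p)` from `q` to the point `r` of the
admissible line `N`: the line `L'` through `p` and `r` lies in the plane on `N` and `L`, and the
line `M'` through `p` and `r` lies in the plane on `N` and `M`. -/
def IsShift (α : PrimitivePath F A) (N : Line F A) (r : Point F A) (β : PrimitivePath F A) :
    Prop :=
  α.Admissible N ∧ r.On N ∧ β.p = α.p ∧ β.q = r ∧
    (∃ ξ : Plane F A, N.On ξ ∧ α.L.On ξ ∧ β.L.On ξ) ∧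
    (∃ χ : Plane F A, N.On χ ∧ α.M.On χ ∧ β.M.On χ)

/-- `β` is an orthogonal shift of `α` along `N`: a shift to a point `r` of `N` with `p ⊥ r`. -/
def IsOrthogonalShift (α : PrimitivePath F A) (N : Line F A) (β : PrimitivePath F A) : Prop :=
  ∃ r : Point F A, α.IsShift N r β ∧ α.p.Perp r

end PrimitivePath

end Geometry

end OP2

namespace OP2

open ComplexConjugate

/-! Represent p by P, q by a unit vector Q, and write L = [a, u] with |a| = 1. Put b = Qa. Then (a,
b) is an orthonormal pair of pure elements with ab = Q, and 1, a, b, Q is a basis of 𝔸, which has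
dimension 4 over 𝔽. As P ⊥ a, one has P = βb + γQ, where β ≠ 0 because p ≠ q, and γ ≠ 0 because p
and q are not orthogonal. The pure vectors orthogonal to P and Q are the multiples of a, so M = [a,
v] for some v.

Choose a unit vector w orthogonal to 1, u and v; there is room for it because 𝕆 has dimension
greater than 3 over 𝔽. Let N = [b, w]. Products of combinations of 1, a, b, ab have the same
coefficients for every orthonormal pair (`OrthonormalPair.quad_mul`), so any pair in 𝔸 can be sent
to any pair in 𝕆 by a plane (`Plane.ofPairs`), which is determined on pure elements
(`Plane.apply_eq_of_pair`). The planes ξ : (a, b) ↦ (u, w) and χ : (a, b) ↦ (v, w) make N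
admissible.

A point of N orthogonal to p is orthogonal to b and P, hence to Q, so it is [a]. A line on p and [a]
has a multiple of c = γ̄b - β̄Q as first component, so the orthogonal shift must consist of [c, ξc]
and [c, χc]. Its invariant is (ξc|χc)/(c|c). The value -1 would force ξc + χc = 0, whereas pairing
this sum with w = ξb = χb gives 2(b|c) = 2γ̄ ≠ 0 (`Plane.form_ne_neg`). -/

/-- The common algebraic properties of `(ℝ, ℍ)`, `(ℝ, 𝕆)` and `(ℂ, 𝕆)`: the form is Hermitian and
positive definite, the norm is multiplicative, and the product of pure elements is a vector product
that is conjugate linear in both variables, up to a scalar part given by the form. -/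
class CrossAlgebra (F A : Type) [RCLike F] [NonAssocRing A] [Star A] [Norm A] [Module F A]
    [HasFPart F A] : Prop where
  conj_form : ∀ x y : A, conj (form F A x y) = form F A y x
  form_smul_right : ∀ (t : F) (x y : A), form F A x (t • y) = t * form F A x y
  form_self : ∀ x : A, form F A x x = ((‖x‖ ^ 2 : ℝ) : F)
  norm_nonneg' : ∀ x : A, 0 ≤ ‖x‖
  eq_zero_of_norm : ∀ x : A, ‖x‖ = 0 → x = 0
  norm_mul' : ∀ x y : A, ‖x * y‖ = ‖x‖ * ‖y‖
  form_one_left : ∀ x : A, form F A 1 x = HasFPart.fPart (F := F) x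
  form_of_pure : ∀ x ∈ Pu F A, ∀ y : A, form F A x y = -HasFPart.fPart (F := F) (x * y)
  mul_smul_one : ∀ (x : A) (t : F), x * t • (1 : A) = t • x
  smul_one_mul : ∀ (t : F), ∀ x ∈ Pu F A, t • (1 : A) * x = conj t • x
  smul_mul_smul_pure : ∀ (s t : F), ∀ x ∈ Pu F A, ∀ y ∈ Pu F A, (s • x) * (t • y) =
    -(conj s * t * form F A x y) • (1 : A) + conj (s * t) • (x * y + form F A x y • (1 : A))
  mul_mul_self : ∀ x ∈ Pu F A, ∀ y : A, x * (x * y) = -((‖x‖ ^ 2 : ℝ) : F) • y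
  mul_anticomm : ∀ x ∈ Pu F A, ∀ y ∈ Pu F A,
    x * y + y * x = -(form F A x y + form F A y x) • (1 : A)
  three_lt_finrank : 3 < Module.finrank F A

/-! ### The three algebras, checked in coordinates -/

theorem norm_sq_quaternion (x : ℍ[ℝ]) :
    ‖x‖ ^ 2 = x.re ^ 2 + x.imI ^ 2 + x.imJ ^ 2 + x.imK ^ 2 := by
  rw [pow_two, ← Quaternion.normSq_eq_norm_mul_self, Quaternion.normSq_def']

instance : CrossAlgebra ℝ ℍ[ℝ] where
  conj_form x y := by simp [form_real_quaternion]; ring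
  form_smul_right t x y := by simp [form_real_quaternion]
  form_self x := by
    rw [norm_sq_quaternion]; simp [form_real_quaternion]; ring
  norm_nonneg' := norm_nonneg
  eq_zero_of_norm x := norm_eq_zero.1
  norm_mul' := norm_mul
  form_one_left x := by simp [form]
  form_of_pure x hx y := by
    rw [mem_Pu_real_quaternion] at hx
    change (star x * y).re = -(x * y).re
    simp [hx]; ring
  mul_smul_one x t := by simp
  smul_one_mul t x _ := by simp
  smul_mul_smul_pure s t x _ y _ := by
    simp only [smul_mul_smul_comm, smul_add, smul_smul, neg_smul, conj_trivial]
    abel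
  mul_mul_self x hx y := by
    rw [mem_Pu_real_quaternion] at hx
    rw [norm_sq_quaternion]
    ext <;> simp [hx] <;> ring
  mul_anticomm x hx y hy := by
    rw [mem_Pu_real_quaternion] at hx hy
    ext <;> simp [form_real_quaternion, hx, hy] <;> ring
  three_lt_finrank := by rw [Quaternion.finrank_eq_four]; norm_num

namespace Octonion

theorem norm_sq_eq (x : Octonion) : ‖x‖ ^ 2 =
    x.fst.re ^ 2 + x.fst.imI ^ 2 + x.fst.imJ ^ 2 + x.fst.imK ^ 2 +
      (x.snd.re ^ 2 + x.snd.imI ^ 2 + x.snd.imJ ^ 2 + x.snd.imK ^ 2) := by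
  rw [norm_sq, norm_sq_quaternion, norm_sq_quaternion]

protected theorem norm_nonneg (x : Octonion) : 0 ≤ ‖x‖ := Real.sqrt_nonneg _

theorem eq_zero_of_norm_eq_zero (x : Octonion) (h : ‖x‖ = 0) : x = 0 := by
  have h1 := norm_sq x
  rw [h] at h1
  have h2 : ‖x.fst‖ = 0 := by nlinarith [sq_nonneg ‖x.fst‖, sq_nonneg ‖x.snd‖]
  have h3 : ‖x.snd‖ = 0 := by nlinarith [sq_nonneg ‖x.fst‖, sq_nonneg ‖x.snd‖]
  ext1
  · exact norm_eq_zero.1 h2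
  · exact norm_eq_zero.1 h3

protected theorem norm_mul (x y : Octonion) : ‖x * y‖ = ‖x‖ * ‖y‖ := by
  refine (sq_eq_sq₀ (Octonion.norm_nonneg _)
    (mul_nonneg (Octonion.norm_nonneg _) (Octonion.norm_nonneg _))).1 ?_
  rw [mul_pow, norm_sq_eq, norm_sq_eq, norm_sq_eq]
  simp
  ring

/-- Alternativity gives x(xy) = x²y, and x² = -|x|² when the real part vanishes. Since ℂ-pure
octonions also have real part 0, this serves both scalar fields. -/
theorem mul_mul_self_of_re (x y : Octonion) (hx : x.fst.re = 0) :
    x * (x * y) = -(‖x‖ ^ 2) • y := by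
  rw [norm_sq_eq]
  ext <;> simp [hx] <;> ring

/-- The octonions as the complex vector space `ℂ⁴`. -/
noncomputable def complexEquiv : Octonion ≃ₗ[ℂ] (Fin 4 → ℂ) where
  -- The sign of `imK` in the second coordinate: scalars act on the right of `fst`, where ji = -k,
  -- but on the left of `snd`, where ij = k.
  toFun x := ![⟨x.fst.re, x.fst.imI⟩, ⟨x.fst.imJ, -x.fst.imK⟩, ⟨x.snd.re, x.snd.imI⟩,
    ⟨x.snd.imJ, x.snd.imK⟩]
  invFun z :=
    ⟨⟨(z 0).re, (z 0).im, (z 1).re, -(z 1).im⟩, ⟨(z 2).re, (z 2).im, (z 3).re, (z 3).im⟩⟩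
  map_add' x y := by
    funext i
    fin_cases i <;> apply Complex.ext <;> simp [add_comm]
  map_smul' c x := by
    funext i
    fin_cases i <;> apply Complex.ext <;> simp <;> ring
  left_inv x := by ext <;> simp
  right_inv z := by
    funext i
    fin_cases i <;> apply Complex.ext <;> simp

theorem finrank_complex : Module.finrank ℂ Octonion = 4 := by
  rw [complexEquiv.finrank_eq, Module.finrank_fin_fun]

end Octonion

instance : CrossAlgebra ℝ Octonion where
  conj_form x y := by simp [form_real_octonion]; ring
  form_smul_right t x y := by simp [form_real_octonion]; ring
  form_self x := by
    rw [Octonion.norm_sq_eq]; simp [form_real_octonion]; ring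
  norm_nonneg' := Octonion.norm_nonneg
  eq_zero_of_norm := Octonion.eq_zero_of_norm_eq_zero
  norm_mul' := Octonion.norm_mul
  form_one_left x := by
    change (star 1 * x).fst.re = x.fst.re
    simp
  form_of_pure x hx y := by
    rw [mem_Pu_real_octonion] at hx
    change (star x * y).fst.re = -(x * y).fst.re
    simp [hx]; ring
  mul_smul_one x t := by ext <;> simp
  smul_one_mul t x _ := by ext <;> simp
  smul_mul_smul_pure s t x _ y _ := by ext <;> simp <;> ring
  mul_mul_self x hx y := Octonion.mul_mul_self_of_re x y hx
  mul_anticomm x hx y hy := by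
    rw [mem_Pu_real_octonion] at hx hy
    ext <;> simp [form_real_octonion, hx, hy] <;> ring
  three_lt_finrank := by
    rw [finrank_real_of_complex, Octonion.finrank_complex]; norm_num

set_option maxHeartbeats 800000 in
instance : CrossAlgebra ℂ Octonion where
  conj_form x y := by apply Complex.ext <;> simp [form_complex_octonion] <;> ring
  form_smul_right t x y := by apply Complex.ext <;> simp [form_complex_octonion] <;> ring
  form_self x := by
    rw [Octonion.norm_sq_eq]
    apply Complex.ext <;> simp [form_complex_octonion, pow_two]; ring
  norm_nonneg' := Octonion.norm_nonneg
  eq_zero_of_norm := Octonion.eq_zero_of_norm_eq_zero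
  norm_mul' := Octonion.norm_mul
  form_one_left x := by
    change form ℂ Octonion 1 x = ⟨x.fst.re, x.fst.imI⟩
    simp [form_complex_octonion]
  form_of_pure x hx y := by
    rw [mem_Pu_complex_octonion] at hx
    change form ℂ Octonion x y = -⟨(x * y).fst.re, (x * y).fst.imI⟩
    apply Complex.ext <;> simp [form_complex_octonion, hx.1, hx.2] <;> ring
  mul_smul_one x t := by ext <;> simp
  smul_one_mul t x hx := by
    rw [mem_Pu_complex_octonion] at hx
    ext <;> simp [hx.1, hx.2] <;> ring
  smul_mul_smul_pure s t x hx y hy := by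
    rw [mem_Pu_complex_octonion] at hx hy
    ext <;> simp [form_complex_octonion, hx.1, hx.2, hy.1, hy.2] <;> ring
  mul_mul_self x hx y := by
    rw [mem_Pu_complex_octonion] at hx
    rw [Octonion.mul_mul_self_of_re x y hx.1]
    ext <;> simp [pow_two] <;> ring
  mul_anticomm x hx y hy := by
    rw [mem_Pu_complex_octonion] at hx hy
    ext <;> simp [form_complex_octonion, hx.1, hx.2, hy.1, hy.2] <;> ring
  three_lt_finrank := by rw [Octonion.finrank_complex]; norm_num

/-! ### Calculus of the form and of products of pure elements -/

namespace CrossAlgebra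

variable {F A : Type} [RCLike F] [NonAssocRing A] [Star A] [Norm A] [Module F A] [HasFPart F A]
theorem form_add_right (x y z : A) : form F A x (y + z) = form F A x y + form F A x z := by
  simp [form, mul_add]

theorem form_neg_right (x y : A) : form F A x (-y) = -form F A x y := by
  simp [form]

theorem form_zero_right (x : A) : form F A x 0 = 0 := by simp [form]

variable [CrossAlgebra F A]

theorem form_add_left (x y z : A) : form F A (x + y) z = form F A x z + form F A y z := by
  simp only [← conj_form (F := F) z, form_add_right, map_add]

theorem form_smul_left (t : F) (x y : A) : form F A (t • x) y = conj t * form F A x y := by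
  rw [← conj_form y, form_smul_right, map_mul, conj_form]

theorem form_eq_zero_symm {x y : A} (h : form F A x y = 0) : form F A y x = 0 := by
  rw [← conj_form, h, map_zero]

theorem mem_Pu_iff {x : A} : x ∈ Pu F A ↔ form F A 1 x = 0 := by
  rw [form_one_left]; exact Iff.rfl

theorem eq_zero_of_form_self {x : A} (h : form F A x x = 0) : x = 0 := by
  rw [form_self] at h
  exact eq_zero_of_norm F x (pow_eq_zero_iff (two_ne_zero)|>.1 (RCLike.ofReal_eq_zero.1 h))

/-- Conjugation is x ↦ -x on pure elements. This turns orthogonality relations into identities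
between products. -/
theorem form_of_mul_pure {x y : A} (hx : x ∈ Pu F A) : form F A x y = -form F A 1 (x * y) := by
  rw [form_of_pure x hx, form_one_left]

theorem norm_eq_norm_of_form_self {B : Type} [NonAssocRing B] [Star B] [Norm B] [Module F B]
    [HasFPart F B] [CrossAlgebra F B] {x : A} {y : B} (h : form F A x x = form F B y y) :
    ‖x‖ = ‖y‖ := by
  rw [form_self, form_self, RCLike.ofReal_inj] at h
  exact (sq_eq_sq₀ (norm_nonneg' F x) (norm_nonneg' F y)).1 h

variable (F A) in
/-- The elements of `A` orthogonal to `x`, `y` and `z` do not all vanish. -/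
theorem exists_ne_zero_orthogonal (x y z : A) :
    ∃ w : A, w ≠ 0 ∧ form F A x w = 0 ∧ form F A y w = 0 ∧ form F A z w = 0 := by
  let f : A →ₗ[F] (Fin 3 → F) :=
    { toFun w := ![form F A x w, form F A y w, form F A z w]
      map_add' v w := by
        funext i
        fin_cases i <;> simp [form_add_right]
      map_smul' t w := by
        funext i
        fin_cases i <;> simp [form_smul_right] }
  -- `finrank` is 0 in infinite dimension, so a positive value gives finiteness.
  have : FiniteDimensional F A :=
    Module.finite_of_finrank_pos ((Nat.zero_lt_succ 2).trans (three_lt_finrank (F := F) (A := A)))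
  have hf : LinearMap.ker f ≠ ⊥ := LinearMap.ker_ne_bot_of_finrank_lt
    (by rw [Module.finrank_fin_fun]; exact three_lt_finrank)
  obtain ⟨w, hw, hw0⟩ := (Submodule.ne_bot_iff _).1 hf
  have hw' : ![form F A x w, form F A y w, form F A z w] = 0 := hw
  exact ⟨w, hw0, congrFun hw' 0, congrFun hw' 1, congrFun hw' 2⟩

/-- A nonzero element has a multiple of norm one. -/
theorem exists_form_smul_self_eq_one {x : A} (hx : x ≠ 0) :
    ∃ t : F, t ≠ 0 ∧ form F A (t • x) (t • x) = 1 := by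
  have hn : ‖x‖ ≠ 0 := fun h => hx (eq_zero_of_norm F x h)
  have hn' : ((‖x‖ : ℝ) : F) ≠ 0 := RCLike.ofReal_ne_zero.2 hn
  refine ⟨(‖x‖⁻¹ : ℝ), RCLike.ofReal_ne_zero.2 (inv_ne_zero hn), ?_⟩
  rw [form_smul_left, form_smul_right, form_self, RCLike.conj_ofReal]
  push_cast
  field_simp

/-! ### Orthonormal pairs and the basis 1, a, b, ab -/

variable (F) in
/-- An orthonormal pair of pure elements. -/
structure OrthonormalPair (a b : A) : Prop where
  left_mem : a ∈ Pu F A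
  right_mem : b ∈ Pu F A
  left_self : form F A a a = 1
  right_self : form F A b b = 1
  left_right : form F A a b = 0

variable (F) in
/-- The linear combination of `1`, `a`, `b` and `a * b` with the given coefficients. -/
def quad (a b : A) (z α β γ : F) : A := z • (1 : A) + α • a + β • b + γ • (a * b)

theorem form_quad (a b : A) (z α β γ : F) (x : A) : form F A (quad F a b z α β γ) x =
    conj z * form F A 1 x + conj α * form F A a x + conj β * form F A b x +
      conj γ * form F A (a * b) x := by
  simp only [quad, form_add_left, form_smul_left]

theorem mul_self_of_unit {x : A} (hx : x ∈ Pu F A) (h : form F A x x = 1) (y : A) :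
    x * (x * y) = -y := by
  rw [mul_mul_self (F := F) x hx, ← form_self, h, neg_one_smul]

theorem mul_swap {x y : A} (hx : x ∈ Pu F A) (hy : y ∈ Pu F A) (h : form F A x y = 0) :
    y * x = -(x * y) := by
  have := mul_anticomm (F := F) x hx y hy
  rw [h, form_eq_zero_symm h, add_zero, neg_zero, zero_smul] at this
  exact eq_neg_of_add_eq_zero_right this

theorem smul_mul_smul_of_orthogonal {x y : A} (hx : x ∈ Pu F A) (hy : y ∈ Pu F A)
    (h : form F A x y = 0) (s t : F) : (s • x) * (t • y) = conj (s * t) • (x * y) := by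
  rw [smul_mul_smul_pure s t x hx y hy, h]
  simp

theorem smul_mul_smul_of_unit {x : A} (hx : x ∈ Pu F A) (h : form F A x x = 1) (s t : F) :
    (s • x) * (t • x) = -(conj s * t) • (1 : A) := by
  have h1 : x * x = -1 := by simpa using mul_self_of_unit hx h 1
  rw [smul_mul_smul_pure s t x hx x hx, h, h1]
  simp

theorem smul_one_mul_smul {x : A} (hx : x ∈ Pu F A) (s t : F) :
    (s • (1 : A)) * (t • x) = (conj s * t) • x := by
  rw [smul_one_mul s _ ((Pu F A).smul_mem t hx), smul_smul]

theorem smul_mul_smul_one (x : A) (s t : F) :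
    (s • x) * (t • (1 : A)) = (t * s) • x := by
  rw [mul_smul_one, smul_smul]

namespace OrthonormalPair

variable {a b : A} (h : OrthonormalPair F a b)
include h

theorem swap : OrthonormalPair F b a :=
  ⟨h.right_mem, h.left_mem, h.right_self, h.left_self, form_eq_zero_symm h.left_right⟩

theorem mul_mem : a * b ∈ Pu F A := by
  rw [mem_Pu_iff, ← neg_eq_zero, ← form_of_mul_pure h.left_mem, h.left_right]

theorem left_mul : form F A a (a * b) = 0 := by
  rw [form_of_mul_pure h.left_mem, mul_self_of_unit h.left_mem h.left_self, form_neg_right,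
    mem_Pu_iff.1 h.right_mem, neg_zero, neg_zero]

theorem mul_swap' : b * a = -(a * b) := mul_swap h.left_mem h.right_mem h.left_right

theorem right_mul : form F A b (a * b) = 0 := by
  have := h.swap.left_mul
  rwa [h.mul_swap', form_neg_right, neg_eq_zero] at this

theorem mul_mul_self_eq : form F A (a * b) (a * b) = 1 := by
  have h1 : ‖a‖ = 1 := by
    have := form_self (F := F) a
    rw [h.left_self] at this
    have h2 : ‖a‖ ^ 2 = 1 := by exact_mod_cast this.symm
    exact (pow_eq_one_iff_of_nonneg (norm_nonneg' F a) two_ne_zero).1 h2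
  rw [form_self, norm_mul' F, h1, one_mul, ← form_self, h.right_self]

theorem one_one : form F A 1 1 = 1 := by
  have h1 : a * a = -1 := by simpa using mul_self_of_unit h.left_mem h.left_self 1
  rw [← h.left_self, form_of_mul_pure h.left_mem, h1, form_neg_right, neg_neg]

/-- The third pair of the cyclic triple `a`, `b`, `a * b`. -/
theorem left_mul_pair : OrthonormalPair F a (a * b) :=
  ⟨h.left_mem, h.mul_mem, h.left_self, h.mul_mul_self_eq, h.left_mul⟩

theorem right_mul_pair : OrthonormalPair F b (a * b) :=
  ⟨h.right_mem, h.mul_mem, h.right_self, h.mul_mul_self_eq, h.right_mul⟩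

theorem left_mul_mul : a * (a * b) = -b := mul_self_of_unit h.left_mem h.left_self b

theorem right_mul_mul : b * (a * b) = a := by
  have := mul_self_of_unit h.right_mem h.right_self a
  rwa [h.mul_swap', mul_neg, neg_inj] at this

theorem mul_mul_left : a * b * a = b := by
  rw [h.left_mul_pair.mul_swap', h.left_mul_mul, neg_neg]

theorem mul_mul_right : a * b * b = -a := by
  rw [h.right_mul_pair.mul_swap', h.right_mul_mul]

/-- The elements a, b, ab multiply like the quaternion units, and the conjugations come from the
vector product being conjugate linear in both variables. The coefficients on the right do not depend
on the pair, which is what makes `Plane.ofPairs` multiplicative. -/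
theorem quad_mul (z α β γ z' α' β' γ' : F) : quad F a b z α β γ * quad F a b z' α' β' γ' =
    quad F a b (z * z' - conj α * α' - conj β * β' - conj γ * γ')
      (conj z * α' + z' * α + conj (β * γ') - conj (γ * β'))
      (conj z * β' + z' * β + conj (γ * α') - conj (α * γ'))
      (conj z * γ' + z' * γ + conj (α * β') - conj (β * α')) := by
  have p := h.left_mul_pair
  have q := h.right_mul_pair
  simp only [quad, add_mul, mul_add, smul_mul_smul_one, smul_one_mul_smul h.left_mem,
    smul_one_mul_smul h.right_mem, smul_one_mul_smul h.mul_mem,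
    smul_mul_smul_of_unit h.left_mem h.left_self, smul_mul_smul_of_unit h.right_mem h.right_self,
    smul_mul_smul_of_unit h.mul_mem h.mul_mul_self_eq,
    smul_mul_smul_of_orthogonal h.left_mem h.right_mem h.left_right,
    smul_mul_smul_of_orthogonal h.right_mem h.left_mem h.swap.left_right,
    smul_mul_smul_of_orthogonal h.left_mem h.mul_mem h.left_mul,
    smul_mul_smul_of_orthogonal h.mul_mem h.left_mem p.swap.left_right,
    smul_mul_smul_of_orthogonal h.right_mem h.mul_mem h.right_mul,
    smul_mul_smul_of_orthogonal h.mul_mem h.right_mem q.swap.left_right,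
    h.mul_swap', h.left_mul_mul, h.right_mul_mul, h.mul_mul_left, h.mul_mul_right]
  module

theorem form_one_quad (z α β γ : F) : form F A 1 (quad F a b z α β γ) = z := by
  simp [quad, form_add_right, form_smul_right, h.one_one, mem_Pu_iff.1 h.left_mem,
    mem_Pu_iff.1 h.right_mem, mem_Pu_iff.1 h.mul_mem]

theorem form_left_quad (z α β γ : F) : form F A a (quad F a b z α β γ) = α := by
  simp [quad, form_add_right, form_smul_right, form_eq_zero_symm (mem_Pu_iff.1 h.left_mem),
    h.left_self, h.left_right, h.left_mul]

theorem form_right_quad (z α β γ : F) : form F A b (quad F a b z α β γ) = β := by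
  simp [quad, form_add_right, form_smul_right, form_eq_zero_symm (mem_Pu_iff.1 h.right_mem),
    h.right_self, h.swap.left_right, h.right_mul]

theorem form_mul_quad (z α β γ : F) : form F A (a * b) (quad F a b z α β γ) = γ := by
  simp [quad, form_add_right, form_smul_right, form_eq_zero_symm (mem_Pu_iff.1 h.mul_mem),
    h.mul_mul_self_eq, h.left_mul_pair.swap.left_right, h.right_mul_pair.swap.left_right]

/-- The form recovers the four coefficients, so 1, a, b, ab are independent, hence a basis in
dimension 4. -/
theorem eq_quad (h4 : Module.finrank F A = 4) (x : A) :
    x = quad F a b (form F A 1 x) (form F A a x) (form F A b x) (form F A (a * b) x) := by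
  let f : (Fin 4 → F) →ₗ[F] A :=
    { toFun v := quad F a b (v 0) (v 1) (v 2) (v 3)
      map_add' v w := by simp only [quad, Pi.add_apply]; module
      map_smul' t v := by simp only [quad, Pi.smul_apply, smul_eq_mul, RingHom.id_apply]; module }
  have hf : Function.Injective f := by
    intro v w hvw
    have hvw' : quad F a b (v 0) (v 1) (v 2) (v 3) = quad F a b (w 0) (w 1) (w 2) (w 3) := hvw
    funext i
    fin_cases i
    · simpa only [h.form_one_quad] using! congrArg (form F A 1) hvw'
    · simpa only [h.form_left_quad] using! congrArg (form F A a) hvw'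
    · simpa only [h.form_right_quad] using! congrArg (form F A b) hvw'
    · simpa only [h.form_mul_quad] using! congrArg (form F A (a * b)) hvw'
  have : FiniteDimensional F A := Module.finite_of_finrank_pos (by rw [h4]; norm_num)
  obtain ⟨v, rfl⟩ := (LinearMap.injective_iff_surjective_of_finrank_eq_finrank
    (by rw [h4, Module.finrank_fin_fun])).1 hf x
  change quad F a b (v 0) (v 1) (v 2) (v 3) = quad F a b (form F A 1 (quad F a b _ _ _ _))
    (form F A a (quad F a b _ _ _ _)) (form F A b (quad F a b _ _ _ _))
    (form F A (a * b) (quad F a b _ _ _ _))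
  rw [h.form_one_quad, h.form_left_quad, h.form_right_quad, h.form_mul_quad]

end OrthonormalPair

end CrossAlgebra

open CrossAlgebra

/-! ### Planes as maps between orthonormal pairs -/

section


variable {F A : Type} [RCLike F] [NonAssocRing A] [Star A] [Norm A] [Module F A] [HasFPart F A]
variable [Module F Octonion] [HasFPart F Octonion]

namespace Plane

theorem map_form (φ : Plane F A) (x y : A) :
    form F Octonion (φ.toLinearMap x) (φ.toLinearMap y) = form F A x y := φ.map_form' x y

variable [CrossAlgebra F A]

/-- A plane is determined on the pure elements by the images of an orthonormal pair. -/
theorem apply_eq_of_pair (h4 : Module.finrank F A = 4) {a b : A} (h : OrthonormalPair F a b)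
    {φ ψ : Plane F A} (ha : φ.toLinearMap a = ψ.toLinearMap a)
    (hb : φ.toLinearMap b = ψ.toLinearMap b) {x : A} (hx : x ∈ Pu F A) :
    φ.toLinearMap x = ψ.toLinearMap x := by
  have hab : φ.toLinearMap (a * b) = ψ.toLinearMap (a * b) :=
    (φ.map_mul' a b).trans ((congrArg₂ (· * ·) ha hb).trans (ψ.map_mul' a b).symm)
  rw [h.eq_quad h4 x, mem_Pu_iff.1 hx]
  simp [quad, ha, hb, hab]

variable [CrossAlgebra F Octonion]

/-- The plane that maps one orthonormal pair of pure elements to another one. -/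
noncomputable def ofPairs (h4 : Module.finrank F A = 4) {a b : A} {u w : Octonion}
    (h : OrthonormalPair F a b) (h' : OrthonormalPair F u w) : Plane F A where
  toFun x := quad F u w (form F A 1 x) (form F A a x) (form F A b x) (form F A (a * b) x)
  map_add' x y := by simp only [quad, form_add_right]; module
  map_smul' t x := by simp only [quad, form_smul_right, RingHom.id_apply]; module
  -- Both products are computed by `quad_mul`, with the same coefficients in 𝔸 and in 𝕆.
  map_mul' x y := by
    rw [h'.quad_mul]
    conv_lhs => rw [h.eq_quad h4 x, h.eq_quad h4 y, h.quad_mul]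
    rw [h.form_one_quad, h.form_left_quad, h.form_right_quad, h.form_mul_quad]
  map_form' x y := by
    conv_rhs => rw [h.eq_quad h4 x]
    rw [form_quad, form_quad, h'.form_one_quad, h'.form_left_quad, h'.form_right_quad,
      h'.form_mul_quad]

theorem ofPairs_left (h4 : Module.finrank F A = 4) {a b : A} {u w : Octonion}
    (h : OrthonormalPair F a b) (h' : OrthonormalPair F u w) :
    (ofPairs h4 h h').toLinearMap a = u := by
  change quad F u w _ _ _ _ = u
  rw [mem_Pu_iff.1 h.left_mem, h.left_self, h.swap.left_right, h.left_mul_pair.swap.left_right]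
  simp [quad]

theorem ofPairs_mem (h4 : Module.finrank F A = 4) {a b : A} {u w : Octonion}
    (h : OrthonormalPair F a b) (h' : OrthonormalPair F u w) {x : A} (hx : x ∈ Pu F A) :
    (ofPairs h4 h h').toLinearMap x ∈ Pu F Octonion := by
  rw [mem_Pu_iff] at hx ⊢
  exact (h'.form_one_quad _ _ _ _).trans hx

theorem ofPairs_right (h4 : Module.finrank F A = 4) {a b : A} {u w : Octonion}
    (h : OrthonormalPair F a b) (h' : OrthonormalPair F u w) :
    (ofPairs h4 h h').toLinearMap b = w := by
  change quad F u w _ _ _ _ = w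
  rw [mem_Pu_iff.1 h.right_mem, h.right_self, h.left_right, h.right_mul_pair.swap.left_right]
  simp [quad]

end Plane

end

/-! ### Normalized representatives and incidence -/

section

variable {F A : Type} [RCLike F] [NonAssocRing A] [Module F A] [Module F Octonion]

theorem mem_pairClass_self (x : A) (u : Octonion) : (x, u) ∈ pairClass (F := F) x u :=
  ⟨1, one_ne_zero, by rw [one_smul, one_smul]⟩

theorem pairClass_smul {t : F} (ht : t ≠ 0) (x : A) (u : Octonion) :
    pairClass (F := F) (t • x) (t • u) = pairClass (F := F) x u := by
  ext w
  constructor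
  · rintro ⟨s, hs, rfl⟩
    exact ⟨s * t, mul_ne_zero hs ht, by rw [mul_smul, mul_smul]⟩
  · rintro ⟨s, hs, rfl⟩
    refine ⟨s * t⁻¹, mul_ne_zero hs (inv_ne_zero ht), ?_⟩
    rw [smul_smul, smul_smul, inv_mul_cancel_right₀ ht]

end

variable {F A : Type} [RCLike F] [NonAssocRing A] [Star A] [Norm A] [Module F A] [HasFPart F A]
variable [CrossAlgebra F A]

theorem Point.exists_unit_rep (p : Point F A) :
    ∃ (x : Pu F A) (hx : x ≠ 0), form F A x x = 1 ∧ p = Projectivization.mk F x hx := by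
  induction p using Projectivization.ind with
  | h x hx =>
    obtain ⟨t, ht, h1⟩ := exists_form_smul_self_eq_one (F := F) (x := (x : A))
      (fun h => hx (Subtype.ext h))
    refine ⟨t • x, smul_ne_zero ht hx, h1, ?_⟩
    exact (Projectivization.mk_eq_mk_iff' F _ _ _ _).2
      ⟨t⁻¹, by rw [smul_smul, inv_mul_cancel₀ ht, one_smul]⟩

theorem Point.mk_perp_iff {x y : Pu F A} (hx : x ≠ 0) (hy : y ≠ 0) :
    Point.Perp (Projectivization.mk F x hx) (Projectivization.mk F y hy) ↔
      form F A x y = 0 := by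
  simp only [Point.Perp, Projectivization.submodule_mk]
  constructor
  · exact fun h => h x (Submodule.mem_span_singleton_self x) y
      (Submodule.mem_span_singleton_self y)
  · intro h x' hx' y' hy'
    obtain ⟨s, rfl⟩ := Submodule.mem_span_singleton.1 hx'
    obtain ⟨t, rfl⟩ := Submodule.mem_span_singleton.1 hy'
    simp [form_smul_left, form_smul_right, h]

variable [Module F Octonion] [HasFPart F Octonion]

omit [CrossAlgebra F A] in
theorem Line.on_plane_iff {L : Line F A} {x : A} {u : Octonion}
    (hL : L.carrier = pairClass (F := F) x u) (φ : Plane F A) :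
    L.On φ ↔ φ.toLinearMap x = u := by
  constructor
  · intro h
    exact h (x, u) (hL ▸ mem_pairClass_self x u)
  · intro h w hw
    rw [hL] at hw
    obtain ⟨t, -, rfl⟩ := hw
    rw [map_smul, h]

theorem Point.mk_on_iff {L : Line F A} {x : A} {u : Octonion}
    (hL : L.carrier = pairClass (F := F) x u) {y : Pu F A} (hy : y ≠ 0) :
    Point.On (Projectivization.mk F y hy) L ↔ form F A x y = 0 := by
  simp only [Point.On, Projectivization.submodule_mk]
  constructor
  · exact fun h => h (x, u) (hL ▸ mem_pairClass_self x u) y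
      (Submodule.mem_span_singleton_self y)
  · intro h w hw y' hy'
    rw [hL] at hw
    obtain ⟨s, -, rfl⟩ := hw
    obtain ⟨t, rfl⟩ := Submodule.mem_span_singleton.1 hy'
    simp [form_smul_left, form_smul_right, h]

variable [CrossAlgebra F Octonion]

theorem Line.exists_unit_rep (L : Line F A) : ∃ x ∈ Pu F A, ∃ u ∈ Pu F Octonion,
    form F A x x = 1 ∧ form F Octonion u u = 1 ∧ L.carrier = pairClass (F := F) x u := by
  obtain ⟨x, hx, u, hu, hn, hu0, hL⟩ := L.exists_rep
  have hu' : u ≠ 0 := by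
    rintro rfl
    -- The octonion norm is a bare function here, so ‖0‖ = 0 is drawn from homogeneity.
    have := HasFPart.norm_smul' (0 : F) (0 : Octonion)
    rw [smul_zero, norm_zero, zero_mul] at this
    exact hu0 this
  obtain ⟨t, ht, h1⟩ := exists_form_smul_self_eq_one (F := F) hu'
  refine ⟨t • x, (Pu F A).smul_mem t hx, t • u, (Pu F Octonion).smul_mem t hu, ?_, h1, ?_⟩
  · rw [← h1, form_self, form_self, HasFPart.norm_smul', HasFPart.norm_smul', hn]
  · rw [hL, pairClass_smul ht]

/-- The line `[x, u]`. -/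
def Line.ofPair (x : A) (u : Octonion) (hx : x ∈ Pu F A) (hu : u ∈ Pu F Octonion)
    (h : form F Octonion u u = form F A x x) (h0 : x ≠ 0) : Line F A where
  carrier := pairClass (F := F) x u
  exists_rep := by
    refine ⟨x, hx, u, hu, (norm_eq_norm_of_form_self h).symm, ?_, rfl⟩
    rw [norm_eq_norm_of_form_self h]
    exact fun hn => h0 (eq_zero_of_norm F x hn)

/-! ### The orthogonal shift -/

/-- If two planes agree on `b`, they do not map `c` to opposite elements unless `b ⊥ c`. -/
theorem Plane.form_ne_neg {φ ψ : Plane F A} {b c : A}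
    (hb : φ.toLinearMap b = ψ.toLinearMap b) (hbc : form F A b c ≠ 0) :
    form F Octonion (φ.toLinearMap c) (ψ.toLinearMap c) ≠ -form F A c c := by
  intro h
  have h' : form F Octonion (ψ.toLinearMap c) (φ.toLinearMap c) = -form F A c c := by
    rw [← conj_form, h, map_neg, conj_form]
  -- Equality case of Cauchy–Schwarz: the sum has square norm (c|c) + (c|c) - 2(c|c) = 0.
  have h0 : φ.toLinearMap c + ψ.toLinearMap c = 0 := by
    refine eq_zero_of_form_self (F := F) ?_
    rw [form_add_left, form_add_right, form_add_right, φ.map_form, ψ.map_form, h, h']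
    ring
  have h1 : form F Octonion (φ.toLinearMap b) (φ.toLinearMap c + ψ.toLinearMap c) =
      2 * form F A b c := by
    rw [form_add_right, φ.map_form, hb, ψ.map_form]
    ring
  rw [h0, form_zero_right] at h1
  exact mul_ne_zero two_ne_zero hbc h1.symm

/-- Using one w for both u and v puts the single line N = [b, w] in a plane with L and in a plane
with M. -/
theorem exists_orthonormalPair_common {u v : Octonion} (hu : u ∈ Pu F Octonion)
    (hv : v ∈ Pu F Octonion) (hu1 : form F Octonion u u = 1) (hv1 : form F Octonion v v = 1) :
    ∃ w, OrthonormalPair F u w ∧ OrthonormalPair F v w := by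
  obtain ⟨w, hw0, h1, huw, hvw⟩ := exists_ne_zero_orthogonal F Octonion 1 u v
  obtain ⟨t, -, ht⟩ := exists_form_smul_self_eq_one (F := F) hw0
  have hw := (Pu F Octonion).smul_mem t (mem_Pu_iff.2 h1)
  exact ⟨t • w, ⟨hu, hw, hu1, ht, by rw [form_smul_right, huw, mul_zero]⟩,
    ⟨hv, hw, hv1, ht, by rw [form_smul_right, hvw, mul_zero]⟩⟩

theorem PrimitivePath.exists_orthogonalShift (h4 : Module.finrank F A = 4)
    (α : PrimitivePath F A) (hα : ¬α.Orthogonal) (hα' : ¬α.Degenerate) :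
    ∃ N : Line F A, α.Admissible N ∧ ∃ β : PrimitivePath F A, α.IsOrthogonalShift N β ∧
      (∀ β' : PrimitivePath F A, α.IsOrthogonalShift N β' → β' = β) ∧
      β.lineInvariant ≠ -1 := by
  obtain ⟨p, L, q, M, hpL, hqL, hqM, hpM⟩ := α
  obtain ⟨P, hP0, -, rfl⟩ := p.exists_unit_rep
  obtain ⟨Q, hQ0, hQ1, rfl⟩ := q.exists_unit_rep
  obtain ⟨a, ha, u, hu, ha1, hu1, hL⟩ := L.exists_unit_rep
  obtain ⟨y, hy, v', hv', hy1, hv'1, hM⟩ := M.exists_unit_rep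
  rw [Point.mk_on_iff hL] at hpL hqL
  rw [Point.mk_on_iff hM] at hpM hqM
  -- Setting b = Qa makes (a, b) an orthonormal pair whose product ab is Q again.
  have k : OrthonormalPair F (Q : A) a := ⟨Q.2, ha, hQ1, ha1, form_eq_zero_symm hqL⟩
  have h := k.right_mul_pair
  have hab : a * (Q * a) = (Q : A) := k.right_mul_mul
  set b : A := Q * a with hb
  have hbQ : form F A b Q = 0 := k.left_mul_pair.swap.left_right
  have expand : ∀ x ∈ Pu F A,
      x = form F A a x • a + form F A b x • b + form F A Q x • (Q : A) := by
    intro x hx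
    have := h.eq_quad h4 x
    rw [mem_Pu_iff.1 hx, hab] at this
    rwa [quad, hab, zero_smul, zero_add] at this
  have hPe := expand P P.2
  rw [hpL, zero_smul, zero_add] at hPe
  set β := form F A b P with hβ
  set γ := form F A Q P with hγ
  have hγ0 : γ ≠ 0 := fun h0 =>
    hα ((Point.mk_perp_iff hP0 hQ0).2 (form_eq_zero_symm h0))
  have hγ0' : conj γ ≠ 0 := (map_ne_zero _).2 hγ0
  have hβ0 : β ≠ 0 := by
    intro h0
    rw [h0, zero_smul, zero_add] at hPe
    exact hα' (Or.inl ((Projectivization.mk_eq_mk_iff' F _ _ _ _).2 ⟨γ, Subtype.ext hPe.symm⟩))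
  have formP : ∀ x : A, form F A P x = conj β * form F A b x + conj γ * form F A Q x := by
    intro x
    conv_lhs => rw [hPe]
    rw [form_add_left, form_smul_left, form_smul_left]
  -- the first component of `M` is a multiple of `a`
  obtain ⟨v, hv, hv1, hM'⟩ : ∃ v ∈ Pu F Octonion, form F Octonion v v = 1 ∧
      M.carrier = pairClass (F := F) a v := by
    -- The first component y of M is orthogonal to Q and P, hence to b as β ≠ 0, so y = ta with |t|
    -- = 1, and t can be divided out.
    have hQy := form_eq_zero_symm hqM
    have hby : form F A b y = 0 := by
      have := formP y
      rw [form_eq_zero_symm hpM, hQy, mul_zero, add_zero] at this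
      exact (mul_eq_zero.1 this.symm).resolve_left ((map_ne_zero _).2 hβ0)
    have hye := expand y hy
    rw [hby, hQy, zero_smul, zero_smul, add_zero, add_zero] at hye
    set t := form F A a y with ht
    have ht1 : conj t * t = 1 := by
      rw [← hy1, hye, form_smul_left, form_smul_right, ha1, mul_one]
    have ht0 : t ≠ 0 := right_ne_zero_of_mul_eq_one ht1
    have hv'e : v' = t • conj t • v' := by rw [smul_smul, mul_comm, ht1, one_smul]
    refine ⟨conj t • v', (Pu F Octonion).smul_mem _ hv', ?_, ?_⟩
    · rw [form_smul_left, form_smul_right, hv'1, mul_one, RCLike.conj_conj, mul_comm, ht1]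
    · rw [hM, hye, hv'e, pairClass_smul ht0, ← hv'e]
  obtain ⟨w, huw, hvw⟩ := exists_orthonormalPair_common hu hv hu1 hv1
  have hb0 : b ≠ 0 := by
    intro h0
    have := h.right_self
    rw [h0, form_zero_right] at this
    exact zero_ne_one this
  let N : Line F A := Line.ofPair b w h.right_mem huw.right_mem
    (huw.right_self.trans h.right_self.symm) hb0
  have hN : N.carrier = pairClass (F := F) b w := rfl
  let ξ := Plane.ofPairs h4 h huw
  let χ := Plane.ofPairs h4 h hvw
  have hξa : ξ.toLinearMap a = u := Plane.ofPairs_left h4 h huw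
  have hξb : ξ.toLinearMap b = w := Plane.ofPairs_right h4 h huw
  have hχa : χ.toLinearMap a = v := Plane.ofPairs_left h4 h hvw
  have hχb : χ.toLinearMap b = w := Plane.ofPairs_right h4 h hvw
  have hqN : Point.On (Projectivization.mk F Q hQ0) N :=
    (Point.mk_on_iff hN hQ0).2 hbQ
  have hadm : PrimitivePath.Admissible ⟨Projectivization.mk F P hP0, L,
      Projectivization.mk F Q hQ0, M, (Point.mk_on_iff hL hP0).2 hpL,
      (Point.mk_on_iff hL hQ0).2 hqL, (Point.mk_on_iff hM hQ0).2 hqM,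
      (Point.mk_on_iff hM hP0).2 hpM⟩ N :=
    ⟨hqN, ⟨ξ, (Line.on_plane_iff hN ξ).2 hξb, (Line.on_plane_iff hL ξ).2 hξa⟩,
      ⟨χ, (Line.on_plane_iff hN χ).2 hχb, (Line.on_plane_iff hM' χ).2 hχa⟩⟩
  -- the common first component of the lines of the orthogonal shift
  let c : A := conj γ • b + (-conj β) • (Q : A)
  have hc : c ∈ Pu F A := (Pu F A).add_mem ((Pu F A).smul_mem _ h.right_mem)
    ((Pu F A).smul_mem _ Q.2)
  have hbc : form F A b c = conj γ := by
    simp only [c, form_add_right, form_smul_right, h.right_self, hbQ]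
    ring
  have hc0 : c ≠ 0 := by
    intro h0
    rw [h0, form_zero_right] at hbc
    exact hγ0' hbc.symm
  have hcP : form F A c P = 0 := by
    simp only [c, form_add_left, form_smul_left, ← hβ, ← hγ, map_neg, RCLike.conj_conj]
    ring
  have hca : form F A c a = 0 := by
    simp only [c, form_add_left, form_smul_left, h.swap.left_right, k.left_right]
    ring
  -- The target of the shift: a is orthogonal to b and to P.
  let r : Pu F A := ⟨a, ha⟩
  have hr0 : r ≠ 0 := by
    intro h0
    have : a = 0 := congrArg Subtype.val h0
    rw [this, form_zero_right] at ha1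
    exact zero_ne_one ha1
  let L' : Line F A := Line.ofPair c (ξ.toLinearMap c) hc (Plane.ofPairs_mem h4 h huw hc)
    (ξ.map_form c c) hc0
  let M' : Line F A := Line.ofPair c (χ.toLinearMap c) hc (Plane.ofPairs_mem h4 h hvw hc)
    (χ.map_form c c) hc0
  have hL' : L'.carrier = pairClass (F := F) c (ξ.toLinearMap c) := rfl
  have hM'' : M'.carrier = pairClass (F := F) c (χ.toLinearMap c) := rfl
  -- The first component of a line on p and [a] is orthogonal to P and a, hence a multiple of c; the
  -- second is its image under a plane already fixed by a and b.
  have uniq : ∀ (K : Line F A) (φ ψ : Plane F A), K.On φ → φ.toLinearMap a = ψ.toLinearMap a →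
      φ.toLinearMap b = ψ.toLinearMap b → Point.On (Projectivization.mk F P hP0) K →
      Point.On (Projectivization.mk F r hr0) K →
      K.carrier = pairClass (F := F) c (ψ.toLinearMap c) := by
    intro K φ ψ hK ea eb hPK hrK
    obtain ⟨x, hx, s, -, hx1, -, hKe⟩ := K.exists_unit_rep
    rw [Point.mk_on_iff hKe] at hPK hrK
    rw [Line.on_plane_iff hKe] at hK
    have hxe := expand x hx
    rw [form_eq_zero_symm hrK, zero_smul, zero_add] at hxe
    have hPx := formP x
    rw [form_eq_zero_symm hPK] at hPx
    have hxc : x = (form F A b x / conj γ) • c := by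
      conv_lhs => rw [hxe]
      simp only [c, smul_add, smul_smul]
      congr 2
      · field_simp
      · field_simp
        linear_combination -hPx
    have ht : form F A b x / conj γ ≠ 0 := by
      intro h0
      rw [h0, zero_smul] at hxc
      rw [hxc, form_zero_right] at hx1
      exact zero_ne_one hx1
    rw [hKe, ← hK, Plane.apply_eq_of_pair h4 h ea eb hx]
    generalize form F A b x / conj γ = t at hxc ht
    rw [hxc, map_smul, pairClass_smul ht]
  refine ⟨N, hadm, ⟨Projectivization.mk F P hP0, L', Projectivization.mk F r hr0, M',
    (Point.mk_on_iff hL' hP0).2 hcP, (Point.mk_on_iff hL' hr0).2 hca,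
    (Point.mk_on_iff hM'' hr0).2 hca, (Point.mk_on_iff hM'' hP0).2 hcP⟩,
    ⟨_, ⟨hadm, (Point.mk_on_iff hN hr0).2 h.swap.left_right, rfl, rfl,
      ⟨ξ, (Line.on_plane_iff hN ξ).2 hξb, (Line.on_plane_iff hL ξ).2 hξa,
        (Line.on_plane_iff hL' ξ).2 rfl⟩,
      ⟨χ, (Line.on_plane_iff hN χ).2 hχb, (Line.on_plane_iff hM' χ).2 hχa,
        (Line.on_plane_iff hM'' χ).2 rfl⟩⟩,
      (Point.mk_perp_iff hP0 hr0).2 (form_eq_zero_symm hpL)⟩, ?_, ?_⟩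
  · rintro ⟨p', K, r', K', hp1, hr1, hr2, hp2⟩
      ⟨r'', ⟨-, hrN, rfl, rfl, ⟨φ, hNφ, hLφ, hKφ⟩, ⟨ψ, hNψ, hMψ, hKψ⟩⟩, hperp⟩
    obtain ⟨R, hR0, -, hR⟩ := Point.exists_unit_rep r'
    dsimp only at hrN hLφ hKφ hMψ hKψ hperp hp1 hp2 hr1 hr2
    rw [hR] at hrN hperp
    rw [Point.mk_on_iff hN] at hrN
    -- From R ⊥ b and P ⊥ R with γ ≠ 0 follows R ⊥ Q, which leaves only multiples of a.
    rw [Point.mk_perp_iff, formP, hrN, mul_zero, zero_add] at hperp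
    have hQR := (mul_eq_zero.1 hperp).resolve_left hγ0'
    have hRe := expand R R.2
    rw [hrN, hQR, zero_smul, zero_smul, add_zero, add_zero] at hRe
    obtain rfl : r' = Projectivization.mk F r hr0 := by
      rw [hR]
      exact (Projectivization.mk_eq_mk_iff' F _ _ _ _).2 ⟨_, Subtype.ext hRe.symm⟩
    rw [Line.on_plane_iff hN] at hNφ hNψ
    rw [Line.on_plane_iff hL] at hLφ
    rw [Line.on_plane_iff hM'] at hMψ
    obtain rfl : K = L' := Line.ext
      (uniq K φ ξ hKφ (hLφ.trans hξa.symm) (hNφ.trans hξb.symm) hp1 hr1)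
    obtain rfl : K' = M' := Line.ext
      (uniq K' ψ χ hKψ (hMψ.trans hχa.symm) (hNψ.trans hχb.symm) hp2 hr2)
    rfl
  · intro hinv
    have hinv' : L'.inner M' = -1 := hinv
    -- Planes preserve the norm, so the denominator of the invariant is (c|c).
    rw [Line.inner_eq L' M' (mem_pairClass_self c _) (mem_pairClass_self c _),
      norm_eq_norm_of_form_self (ξ.map_form c c), norm_eq_norm_of_form_self (χ.map_form c c),
      ← pow_two, ← form_self] at hinv'
    have hcc : form F A c c ≠ 0 := fun h0 => hc0 (eq_zero_of_form_self h0)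
    rw [div_eq_iff hcc, neg_one_mul] at hinv'
    exact Plane.form_ne_neg (hξb.trans hχb.symm) (by rw [hbc]; exact hγ0') hinv'

end OP2

theorem lemma3p13 :
    (∀ α : OP2.PrimitivePath ℝ ℍ[ℝ], ¬ α.Orthogonal → ¬ α.Degenerate →
      ∃ N : OP2.Line ℝ ℍ[ℝ], α.Admissible N ∧
        ∃ β : OP2.PrimitivePath ℝ ℍ[ℝ], α.IsOrthogonalShift N β ∧
          (∀ β' : OP2.PrimitivePath ℝ ℍ[ℝ], α.IsOrthogonalShift N β' → β' = β) ∧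
          β.lineInvariant ≠ -1) ∧
    (∀ α : OP2.PrimitivePath ℂ OP2.Octonion, ¬ α.Orthogonal → ¬ α.Degenerate →
      ∃ N : OP2.Line ℂ OP2.Octonion, α.Admissible N ∧
        ∃ β : OP2.PrimitivePath ℂ OP2.Octonion, α.IsOrthogonalShift N β ∧
          (∀ β' : OP2.PrimitivePath ℂ OP2.Octonion, α.IsOrthogonalShift N β' → β' = β) ∧
          β.lineInvariant ≠ -1) :=
  ⟨OP2.PrimitivePath.exists_orthogonalShift Quaternion.finrank_eq_four,
    OP2.PrimitivePath.exists_orthogonalShift OP2.Octonion.finrank_complex⟩
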